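/- **Attention layers and Transformers.** For $\lambda>0$ let $\mathrm{Softmax}_\lambda$ act on the columns of a matrix by $\mathrm{Softmax}_\lambda(u)_i=e^{\lambda u_i}/\sum_j e^{\lambda u_j}$. An $H$-head attention layer $\mathrm{Attn}:\mathbb{R}^{a\times m}\to\mathbb{R}^{b\times m}$ is a map $$\mathrm{Attn}(Z)=\sum_{h=1}^{H}W_V^{(h)}Z\,\mathrm{Softmax}_\lambda\big((W_K^{(h)}Z)^\top W_Q^{(h)}Z\big),\qquad W_K^{(h)},W_Q^{(h)}\in\mathbb{R}^{d_h\times a},\ W_V^{(h)}\in\mathbb{R}^{b\times a}.$$ Let $P(X)=\begin{bmatrix}X\ \ 0\\ I_{n+1}\end{bmatrix}$ for $X\in\mathbb{R}^{d\times n}$ (one zero token is padded and a positional encoding is appended), and let $T$ delete the last column. The class $\mathcal{T}(H,W,K,C_{KQ},C_V)$ at inverse temperature $\lambda$ consists of the maps $\tau=T\circ\mathrm{Attn}^{(K)}\circ\cdots\circ\mathrm{Attn}^{(1)}\circ P$, where each $\mathrm{Attn}^{(j)}$ is an $H$-head attention layer with inverse temperature $\lambda$, $W$ is the maximum of all token dimensions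 (including the input dimension $d+n+1$ of $\mathrm{Attn}^{(1)}$ and the output dimension) and of all head dimensions $d_h$, $C_V$ is the maximum over all layers and heads of $\|W_V\|_F$, and $C_{KQ}$ is the maximum of $\|W_K^\top W_Q\|_F$. A map on scalars is understood with $d=n=1$ and output dimension $1$, so that the input is a $1\times 1$ matrix. **Proposition (Approximation of the square root).** There are an absolute constant $C>0$ and real polynomials $p,q$ such that the following holds. For every $C_X>0$ and every $\epsilon\in(0,1)$ there are $H,W,K\in\mathbb{N}$, $C_{KQ},C_V,\lambda>0$ and a Transformer $f_{\mathrm{root}}\in\mathcal{T}(H,W,K,C_{KQ},C_V)$ with inverse temperature $\lambda$ such that $$|f_{\mathrm{root}}(x')-\sqrt{x}|\le 2\epsilon+\frac{|x'-x|}{\sqrt{\epsilon}}\qquad\text{for all }x'\in[-C_X,C_X],\ x\in[\epsilon,1/\epsilon].$$ Moreover, if $C_X\ge 1$ and $\epsilon\le 1/2$, then with $\delta=1/\epsilon$ the same network satisfies $$H\le C\ln^3\delta,\quad W\le C\ln^3\delta,\quad K\le C\ln^2\delta,\quad C_V\le C\,\delta\sqrt{\ln^3\delta},\quad C_{KQ}\le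 C\sqrt{\ln^2\delta\cdot\ln(\delta C_X)},$$ $$\lambda\le C\,\delta^{\,p(\ln\delta)}\,(\ln\delta)^{\,q(\ln\delta)}\,\ln(\delta C_X).$$ -/

import Mathlib

noncomputable section

/-- Column-wise softmax with inverse temperature `lam`. -/
def colSoftmax {m n : ℕ} (lam : ℝ) (S : Matrix (Fin m) (Fin n) ℝ) : Matrix (Fin m) (Fin n) ℝ :=
  Matrix.of fun p q => Real.exp (lam * S p q) / ∑ r, Real.exp (lam * S r q)

/-- The weights of one attention head, with its own key/query dimension `dh`. -/
structure AttnHead (dIn dOut : ℕ) where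
  dh : ℕ
  WK : Matrix (Fin dh) (Fin dIn) ℝ
  WQ : Matrix (Fin dh) (Fin dIn) ℝ
  WV : Matrix (Fin dOut) (Fin dIn) ℝ

/-- The key-query matrix `W_Kᵀ W_Q` of a head. -/
def AttnHead.WKQ {dIn dOut : ℕ} (h : AttnHead dIn dOut) : Matrix (Fin dIn) (Fin dIn) ℝ :=
  h.WK.transpose * h.WQ

/-- The map `Z ↦ W_V Z Softmax_lam((W_K Z)ᵀ W_Q Z)` computed by one head. -/
def AttnHead.eval {dIn dOut m : ℕ} (h : AttnHead dIn dOut) (lam : ℝ)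
    (Z : Matrix (Fin dIn) (Fin m) ℝ) : Matrix (Fin dOut) (Fin m) ℝ :=
  h.WV * Z * colSoftmax lam ((h.WK * Z).transpose * (h.WQ * Z))

/-- The multi-head attention layer: the sum of its `H` heads. -/
def attnLayer {H dIn dOut m : ℕ} (heads : Fin H → AttnHead dIn dOut) (lam : ℝ)
    (Z : Matrix (Fin dIn) (Fin m) ℝ) : Matrix (Fin dOut) (Fin m) ℝ :=
  ∑ h, (heads h).eval lam Z

/-- A finite sequence of `H`-head attention layers with composable token dimensions; the first
layer of `cons` acts first. -/
inductive AttnStack (H : ℕ) : ℕ → ℕ → Type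
  | nil (d : ℕ) : AttnStack H d d
  | cons {a b c : ℕ} (layer : Fin H → AttnHead a b) (rest : AttnStack H b c) : AttnStack H a c

namespace AttnStack

/-- The composition of the layers. -/
def eval {H m : ℕ} (lam : ℝ) : {a c : ℕ} → AttnStack H a c →
    Matrix (Fin a) (Fin m) ℝ → Matrix (Fin c) (Fin m) ℝ
  | _, _, nil _, Z => Z
  | _, _, cons layer rest, Z => eval lam rest (attnLayer layer lam Z)

/-- The number of layers. -/
def depth {H : ℕ} : {a c : ℕ} → AttnStack H a c → ℕ
  | _, _, nil _ => 0
  | _, _, cons _ rest => depth rest + 1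

/-- The maximum of all token dimensions (input and output included) and of all key/query
dimensions of heads. -/
def width {H : ℕ} : {a c : ℕ} → AttnStack H a c → ℕ
  | _, _, nil d => d
  | a, _, cons layer rest =>
      max (max a (Finset.univ.sup fun h => (layer h).dh)) (width rest)

open scoped Matrix.Norms.Frobenius in
/-- The maximal Frobenius norm of a value matrix. -/
def maxNormV {H : ℕ} : {a c : ℕ} → AttnStack H a c → ℝ
  | _, _, nil _ => 0
  | _, _, cons layer rest => max (⨆ h, ‖(layer h).WV‖) (maxNormV rest)

open scoped Matrix.Norms.Frobenius in
/-- The maximal Frobenius norm of a key-query matrix `W_Kᵀ W_Q`. -/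
def maxNormKQ {H : ℕ} : {a c : ℕ} → AttnStack H a c → ℝ
  | _, _, nil _ => 0
  | _, _, cons layer rest => max (⨆ h, ‖(layer h).WKQ‖) (maxNormKQ rest)

end AttnStack

/-- The preprocessing layer: pad one zero token and append the positional encoding, that is
`X ↦ [X, 0; I]`, where the lower block is the identity matrix of size `n + 1`. -/
def preprocess {d n : ℕ} (X : Matrix (Fin d) (Fin n) ℝ) :
    Matrix (Fin (d + (n + 1))) (Fin (n + 1)) ℝ :=
  Matrix.of fun r c =>
    Fin.addCases (fun i : Fin d => (Fin.snoc (X i) 0 : Fin (n + 1) → ℝ) c)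
      (fun k : Fin (n + 1) => if k = c then (1 : ℝ) else 0) r

/-- The truncation layer: delete the last token. -/
def truncateLast {d n : ℕ} (Y : Matrix (Fin d) (Fin (n + 1)) ℝ) : Matrix (Fin d) (Fin n) ℝ :=
  Y.submatrix id Fin.castSucc

/-- The Transformer network class with `H` heads per layer, width `W`, `K` attention layers, maximal
key-query norm `CKQ`, maximal value norm `CV`, all of whose softmaxes have inverse temperature
`lam`; its members map `d × n` inputs to `dOut × n` outputs. -/
def TransformerClass (d n dOut H W K : ℕ) (CKQ CV lam : ℝ) :
    Set (Matrix (Fin d) (Fin n) ℝ → Matrix (Fin dOut) (Fin n) ℝ) :=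
  {τ | ∃ s : AttnStack H (d + (n + 1)) dOut,
    s.depth = K ∧ s.width = W ∧ s.maxNormKQ = CKQ ∧ s.maxNormV = CV ∧
      ∀ X, τ X = truncateLast (s.eval lam (preprocess X))}

end

/-!
With two tokens, one of which gets the score `v` and the other the score zero, softmax gives the
first the weight `(1 + tanh (v / 2)) / 2`. A head scoring by the positional encoding therefore
yields, after subtraction of a head with constant scores, a value gated by a hyperbolic tangent,
while two heads with input-independent scores are enough to compute a linear map exactly. Since
`tanh` is nearly linear at small scales and nearly a sign at large ones,
`tanh (Λ * (η * x - y * tanh (η * y)))` approximates the sign of `x - y ^ 2`, and two attention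
layers perform one step of a bisection for `√x` on `[0, 1 / √ε]`, where errors made close to the
target are harmless. It takes `O(log (1 / ε))` steps to reach the accuracy `ε`. The term
`|x' - x| / √ε` comes from the Lipschitz bound of the square root on `[ε, ∞)`.
-/

section HyperbolicTangent

theorem sigmoid_eq_one_add_tanh_half_div_two (v : ℝ) :
    Real.sigmoid v = (1 + Real.tanh (v / 2)) / 2 := by
  have hexp : Real.exp (-v) = Real.exp (-(v / 2)) * Real.exp (-(v / 2)) := by
    rw [← Real.exp_add]
    ring_nf
  rw [Real.sigmoid_def, Real.tanh_eq, hexp, Real.exp_neg]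
  field_simp
  ring

theorem one_sub_tanh_le {v : ℝ} (hv : 0 ≤ v) : 1 - Real.tanh v ≤ 1 / (1 + v) := by
  have hsigmoid : 1 - Real.tanh v = 2 * Real.sigmoid (-(2 * v)) := by
    rw [sigmoid_eq_one_add_tanh_half_div_two, show -(2 * v) / 2 = -v by ring, Real.tanh_neg]
    ring
  rw [hsigmoid, Real.sigmoid_def, neg_neg, ← div_eq_mul_inv,
    div_le_div_iff₀ (by positivity) (by positivity)]
  linarith [Real.add_one_le_exp (2 * v)]

theorem one_sub_le_tanh_of_one_div_le {τ v : ℝ} (hτ : 0 < τ) (hv : 1 / τ ≤ v) :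
    1 - τ ≤ Real.tanh v := by
  have hτv : 1 / (1 + v) ≤ 1 / (1 / τ) :=
    one_div_le_one_div_of_le (by positivity) (by linarith)
  rw [one_div_one_div] at hτv
  linarith [one_sub_tanh_le ((one_div_pos.2 hτ).le.trans hv)]

theorem tanh_le_self {v : ℝ} (hv : 0 ≤ v) : Real.tanh v ≤ v := by
  have hmono : MonotoneOn (fun u : ℝ => u * Real.cosh u - Real.sinh u) (Set.Ici 0) := by
    refine monotoneOn_of_deriv_nonneg (convex_Ici 0) (by fun_prop) (by fun_prop) fun u hu => ?_
    rw [interior_Ici, Set.mem_Ioi] at hu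
    have hderiv : HasDerivAt (fun u : ℝ => u * Real.cosh u - Real.sinh u)
        (1 * Real.cosh u + u * Real.sinh u - Real.cosh u) u :=
      ((hasDerivAt_id u).mul (Real.hasDerivAt_cosh u)).sub (Real.hasDerivAt_sinh u)
    rw [hderiv.deriv]
    linarith [mul_nonneg hu.le (Real.sinh_nonneg_iff.2 hu.le)]
  rw [Real.tanh_eq_sinh_div_cosh, div_le_iff₀ (Real.cosh_pos v)]
  simpa using hmono Set.self_mem_Ici hv hv

theorem one_sub_sq_half_le_inv_cosh (v : ℝ) : 1 - v ^ 2 / 2 ≤ (Real.cosh v)⁻¹ :=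
  calc
    1 - v ^ 2 / 2 ≤ Real.exp (-(v ^ 2 / 2)) := by linarith [Real.add_one_le_exp (-(v ^ 2 / 2))]
    _ = (Real.exp (v ^ 2 / 2))⁻¹ := Real.exp_neg _
    _ ≤ (Real.cosh v)⁻¹ := inv_anti₀ (Real.cosh_pos v) (Real.cosh_le_exp_half_sq v)

theorem self_sub_cube_half_le_tanh {v : ℝ} (hv : 0 ≤ v) : v - v ^ 3 / 2 ≤ Real.tanh v :=
  calc
    v - v ^ 3 / 2 = v * (1 - v ^ 2 / 2) := by ring
    _ ≤ v * (Real.cosh v)⁻¹ := by gcongr; exact one_sub_sq_half_le_inv_cosh v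
    _ ≤ Real.sinh v * (Real.cosh v)⁻¹ := by
      gcongr
      exact Real.self_le_sinh_iff.2 hv
    _ = Real.tanh v := by rw [Real.tanh_eq_sinh_div_cosh, div_eq_mul_inv]

theorem abs_tanh_sub_self_le (v : ℝ) : |Real.tanh v - v| ≤ |v| ^ 3 / 2 := by
  wlog hv : 0 ≤ v generalizing v
  · have hneg := this (-v) (by linarith)
    rwa [Real.tanh_neg, neg_sub_neg, abs_sub_comm, abs_neg] at hneg
  rw [abs_of_nonneg hv, abs_of_nonpos (by linarith [tanh_le_self hv])]
  linarith [self_sub_cube_half_le_tanh hv]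

theorem abs_mul_tanh_mul_sub_mul_sq_le {η y R : ℝ} (hη : 0 ≤ η) (hy : |y| ≤ R) :
    |y * Real.tanh (η * y) - η * y ^ 2| ≤ η ^ 3 * R ^ 4 / 2 :=
  calc
    |y * Real.tanh (η * y) - η * y ^ 2| = |y| * |Real.tanh (η * y) - η * y| := by
      rw [← abs_mul]
      ring_nf
    _ ≤ |y| * (|η * y| ^ 3 / 2) := by gcongr; exact abs_tanh_sub_self_le _
    _ = η ^ 3 * |y| ^ 4 / 2 := by
      rw [abs_mul, abs_of_nonneg hη]
      ring
    _ ≤ η ^ 3 * R ^ 4 / 2 := by gcongr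

end HyperbolicTangent

section SoftBisection

/-- The result of `n` steps of bisection from the approximation `y` with first step width `s`, the
step widths being halved each time. The real number `g y ∈ [-1, 1]` plays the role of the sign that
tells on which side of `y` the target lies. -/
noncomputable def softBisect (g : ℝ → ℝ) : ℕ → ℝ → ℝ → ℝ
  | 0, _, y => y
  | n + 1, s, y => softBisect g n (s / 2) (y + s * g y)

/-- On `S`, the function `g` is an approximate version of `y ↦ sign (r - y)`: it is correct up to
`τ` where `y` is farther than `μ` from `r`, and only bounded by one elsewhere. -/
structure IsSoftSignOn (g : ℝ → ℝ) (r μ τ : ℝ) (S : Set ℝ) : Prop where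
  abs_le_one : ∀ y ∈ S, |g y| ≤ 1
  one_sub_le : ∀ y ∈ S, y < r - μ → 1 - τ ≤ g y
  le_neg_one_sub : ∀ y ∈ S, r + μ < y → g y ≤ -(1 - τ)

variable {g : ℝ → ℝ} {r μ τ : ℝ}

theorem IsSoftSignOn.mono {S T : Set ℝ} (hg : IsSoftSignOn g r μ τ T) (hST : S ⊆ T) :
    IsSoftSignOn g r μ τ S :=
  ⟨fun y hy => hg.abs_le_one y (hST hy), fun y hy => hg.one_sub_le y (hST hy),
    fun y hy => hg.le_neg_one_sub y (hST hy)⟩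

theorem IsSoftSignOn.abs_add_mul_sub_le {S : Set ℝ} {y s E : ℝ} (hg : IsSoftSignOn g r μ τ S)
    (hyS : y ∈ S) (hs : 0 ≤ s) (hτ : 0 ≤ τ) (hμ : 0 ≤ μ) (hE : μ ≤ E)
    (hy : |y - r| ≤ 2 * s + E) : |y + s * g y - r| ≤ s + (E + τ * s) := by
  have hsτ : 0 ≤ τ * s := mul_nonneg hτ hs
  have hstep : |s * g y| ≤ s := by
    rw [abs_mul, abs_of_nonneg hs]
    exact mul_le_of_le_one_right hs (hg.abs_le_one y hyS)
  rw [abs_le] at hy hstep ⊢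
  rcases lt_or_ge y (r - μ) with hlow | hlow
  · have := mul_le_mul_of_nonneg_left (hg.one_sub_le y hyS hlow) hs
    constructor <;> linarith
  rcases lt_or_ge (r + μ) y with hhigh | hhigh
  · have := mul_le_mul_of_nonneg_left (hg.le_neg_one_sub y hyS hhigh) hs
    constructor <;> linarith
  · constructor <;> linarith

theorem IsSoftSignOn.abs_softBisect_sub_le (hτ : 0 ≤ τ) (hμ : 0 ≤ μ) (n : ℕ) {s y E : ℝ}
    (hg : IsSoftSignOn g r μ τ (Metric.closedBall y (2 * s))) (hs : 0 ≤ s) (hE : μ ≤ E)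
    (hy : |y - r| ≤ 2 * s + E) :
    |softBisect g n s y - r| ≤ 2 * s / 2 ^ n + E + 2 * τ * s := by
  induction n generalizing s y E with
  | zero =>
    have : 0 ≤ τ * s := mul_nonneg hτ hs
    rw [softBisect]
    linarith
  | succ n ih =>
    have hmem : y ∈ Metric.closedBall y (2 * s) := Metric.mem_closedBall_self (by positivity)
    have hball : Metric.closedBall (y + s * g y) (2 * (s / 2)) ⊆ Metric.closedBall y (2 * s) := by
      refine Metric.closedBall_subset_closedBall' ?_
      have := mul_le_of_le_one_right hs (hg.abs_le_one y hmem)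
      rw [dist_self_add_left, Real.norm_eq_abs, abs_mul, abs_of_nonneg hs]
      linarith
    have hstep := hg.abs_add_mul_sub_le hmem hs hτ hμ hE hy
    calc
      |softBisect g (n + 1) s y - r| ≤
          2 * (s / 2) / 2 ^ n + (E + τ * s) + 2 * τ * (s / 2) :=
        ih (hg.mono hball) (by positivity) (by linarith [mul_nonneg hτ hs]) (by linarith)
      _ = 2 * s / 2 ^ (n + 1) + E + 2 * τ * s := by
        field_simp
        ring

end SoftBisection

section SquareRoot

/-- The square root of the point of `[0, R ^ 2]` nearest to `x`, which is the number that bisection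
on `[0, R]` finds when it compares `y ^ 2` with an arbitrary real number `x`. -/
noncomputable def clippedSqrt (R x : ℝ) : ℝ :=
  √(Set.projIcc 0 (R ^ 2) (sq_nonneg R) x)

theorem sq_clippedSqrt (R x : ℝ) : clippedSqrt R x ^ 2 = max 0 (min (R ^ 2) x) :=
  Real.sq_sqrt (Subtype.prop (Set.projIcc 0 (R ^ 2) (sq_nonneg R) x)).1

theorem clippedSqrt_mem_Icc {R : ℝ} (hR : 0 ≤ R) (x : ℝ) : clippedSqrt R x ∈ Set.Icc 0 R :=
  ⟨Real.sqrt_nonneg _,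
    Real.sqrt_le_iff.2 ⟨hR, (Subtype.prop (Set.projIcc 0 (R ^ 2) (sq_nonneg R) x)).2⟩⟩

theorem sq_clippedSqrt_le {R x : ℝ} (h : 0 < clippedSqrt R x) : clippedSqrt R x ^ 2 ≤ x := by
  have hpos := pow_pos h 2
  rw [sq_clippedSqrt] at hpos ⊢
  have hmin : 0 < min (R ^ 2) x := (lt_max_iff.1 hpos).resolve_left (lt_irrefl 0)
  rw [max_eq_right hmin.le]
  exact min_le_right _ _

theorem le_sq_clippedSqrt {R x : ℝ} (h : clippedSqrt R x < R) : x ≤ clippedSqrt R x ^ 2 := by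
  have hlt : clippedSqrt R x ^ 2 < R ^ 2 := pow_lt_pow_left₀ h (Real.sqrt_nonneg _) two_ne_zero
  rw [sq_clippedSqrt] at hlt ⊢
  have hx : x < R ^ 2 :=
    (min_lt_iff.1 ((le_max_right _ _).trans_lt hlt)).resolve_left (lt_irrefl _)
  rw [min_eq_right hx.le]
  exact le_max_right _ _

theorem abs_sqrt_sub_sqrt_le {a b c : ℝ} (ha : 0 ≤ a) (hc : 0 < c) (hcb : c ≤ b) :
    |√a - √b| ≤ |a - b| / √c := by
  have hfactor : a - b = (√a - √b) * (√a + √b) := by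
    linear_combination Real.sq_sqrt (hc.le.trans hcb) - Real.sq_sqrt ha
  have hsum : √c ≤ √a + √b := by linarith [Real.sqrt_nonneg a, Real.sqrt_le_sqrt hcb]
  rw [le_div_iff₀ (Real.sqrt_pos.2 hc), hfactor, abs_mul,
    abs_of_nonneg (a := √a + √b) (by positivity)]
  gcongr

theorem abs_clippedSqrt_sub_sqrt_le {c x R : ℝ} (hc : 0 < c) (hx : x ∈ Set.Icc c (R ^ 2))
    (x' : ℝ) : |clippedSqrt R x' - √x| ≤ |x' - x| / √c := by
  have hproj : (Set.projIcc 0 (R ^ 2) (sq_nonneg R) x : ℝ) = x :=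
    congrArg Subtype.val (Set.projIcc_of_mem (sq_nonneg R) ⟨hc.le.trans hx.1, hx.2⟩)
  calc
    |clippedSqrt R x' - √x| ≤ |Set.projIcc 0 (R ^ 2) (sq_nonneg R) x' - x| / √c :=
      abs_sqrt_sub_sqrt_le (Subtype.prop (Set.projIcc 0 (R ^ 2) (sq_nonneg R) x')).1 hc hx.1
    _ ≤ |x' - x| / √c := by
      refine div_le_div_of_nonneg_right ?_ (Real.sqrt_nonneg c)
      nth_rewrite 1 [← hproj]
      exact Set.abs_projIcc_sub_projIcc (sq_nonneg R)

/-- The comparison of `y ^ 2` with `x` that uses only hyperbolic tangents: the inner one replaces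
the square, at the small scale `η`, and the outer one replaces the sign, at the large scale `Λ`. -/
noncomputable def sqCompare (η Λ x y : ℝ) : ℝ :=
  Real.tanh (Λ * (η * x - y * Real.tanh (η * y)))

theorem isSoftSignOn_sqCompare {η Λ R μ τ : ℝ} (hη : 0 ≤ η) (hΛ : 0 ≤ Λ) (hμ : 0 ≤ μ) (hτ : 0 < τ)
    (hημ : η ^ 2 * R ^ 4 ≤ μ ^ 2) (hΛτ : 1 / τ ≤ Λ * (η * μ ^ 2 / 2)) (x : ℝ) :
    IsSoftSignOn (sqCompare η Λ x) (clippedSqrt R x) μ τ (Set.Icc 0 R) := by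
  set r := clippedSqrt R x
  have hr0 : 0 ≤ r := Real.sqrt_nonneg _
  have hsquare : ∀ y ∈ Set.Icc 0 R, |y * Real.tanh (η * y) - η * y ^ 2| ≤ η * μ ^ 2 / 2 := by
    intro y hy
    calc
      |y * Real.tanh (η * y) - η * y ^ 2| ≤ η ^ 3 * R ^ 4 / 2 :=
        abs_mul_tanh_mul_sub_mul_sq_le hη (abs_le.2 ⟨by linarith [hy.1, hy.2], hy.2⟩)
      _ = η * (η ^ 2 * R ^ 4) / 2 := by ring
      _ ≤ η * μ ^ 2 / 2 := by gcongr
  refine ⟨fun y _ => (Real.abs_tanh_lt_one _).le, fun y hy hlow => ?_, fun y hy hhigh => ?_⟩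
  · have hgap : μ ^ 2 ≤ x - y ^ 2 := by
      have hrx : r ^ 2 ≤ x := sq_clippedSqrt_le (by linarith [hy.1] : 0 < r)
      nlinarith [hy.1]
    have hdiff : η * μ ^ 2 / 2 ≤ η * x - y * Real.tanh (η * y) := by
      linarith [(abs_le.1 (hsquare y hy)).2, mul_le_mul_of_nonneg_left hgap hη]
    exact one_sub_le_tanh_of_one_div_le hτ (hΛτ.trans (by gcongr))
  · have hgap : μ ^ 2 ≤ y ^ 2 - x := by
      have hxr : x ≤ r ^ 2 := le_sq_clippedSqrt (by linarith [hy.2] : r < R)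
      nlinarith
    have hdiff : η * μ ^ 2 / 2 ≤ -(η * x - y * Real.tanh (η * y)) := by
      linarith [(abs_le.1 (hsquare y hy)).1, mul_le_mul_of_nonneg_left hgap hη]
    have htanh := one_sub_le_tanh_of_one_div_le hτ (hΛτ.trans (mul_le_mul_of_nonneg_left hdiff hΛ))
    rw [mul_neg, Real.tanh_neg] at htanh
    exact le_neg_of_le_neg htanh

theorem isSoftSignOn_sqCompare_of_sq_eq_one_div {ε R : ℝ} (hε : 0 < ε)
    (hR2 : R ^ 2 = 1 / ε) (x : ℝ) :
    IsSoftSignOn (sqCompare (ε ^ 2 / 2) (16 * (1 / ε) ^ 6) x) (clippedSqrt R x) (ε / 2) (ε ^ 2)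
      (Set.Icc 0 R) := by
  refine isSoftSignOn_sqCompare (by positivity) (by positivity) (by positivity)
    (by positivity) ?_ ?_ x
  · rw [show R ^ 4 = (R ^ 2) ^ 2 by ring, hR2]
    field_simp
    norm_num
  · field_simp
    norm_num

theorem abs_softBisect_sqCompare_sub_sqrt_le {ε x' x : ℝ} (hε0 : 0 < ε) (hε1 : ε < 1)
    (hx : x ∈ Set.Icc ε (1 / ε)) {n : ℕ} (hn : (1 / ε) ^ 2 ≤ 2 ^ n) :
    |softBisect (sqCompare (ε ^ 2 / 2) (16 * (1 / ε) ^ 6) x') n (√(1 / ε) / 4) (√(1 / ε) / 2) -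
      √x| ≤ 2 * ε + |x' - x| / √ε := by
  set R := √(1 / ε)
  set g := sqCompare (ε ^ 2 / 2) (16 * (1 / ε) ^ 6) x'
  have hR2 : R ^ 2 = 1 / ε := Real.sq_sqrt (by positivity)
  have hR1 : 1 ≤ R := Real.one_le_sqrt.2 ((one_lt_div hε0).2 hε1).le
  have hRε : ε * R ≤ 1 :=
    calc
      ε * R ≤ ε * R ^ 2 := by gcongr; exact le_self_pow₀ hR1 two_ne_zero
      _ = 1 := by rw [hR2]; field_simp
  have hsign : IsSoftSignOn g (clippedSqrt R x') (ε / 2) (ε ^ 2)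
      (Metric.closedBall (R / 2) (2 * (R / 4))) := by
    rw [Real.closedBall_eq_Icc, show R / 2 - 2 * (R / 4) = 0 by ring,
      show R / 2 + 2 * (R / 4) = R by ring]
    exact isSoftSignOn_sqCompare_of_sq_eq_one_div hε0 hR2 x'
  have hcenter : |R / 2 - clippedSqrt R x'| ≤ 2 * (R / 4) + ε / 2 := by
    obtain ⟨hr0, hrR⟩ := clippedSqrt_mem_Icc (by positivity : 0 ≤ R) x'
    rw [abs_le]
    constructor <;> linarith
  have hbisect := hsign.abs_softBisect_sub_le (by positivity) (by positivity) n (by positivity)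
    le_rfl hcenter
  have hwidth : 2 * (R / 4) / 2 ^ n ≤ ε := by
    rw [div_le_iff₀ (by positivity)]
    calc
      2 * (R / 4) ≤ R ^ 2 := by nlinarith
      _ = ε * (1 / ε) ^ 2 := by rw [hR2]; field_simp
      _ ≤ ε * 2 ^ n := by gcongr
  have hsoft : 2 * ε ^ 2 * (R / 4) ≤ ε / 2 := by
    linarith [mul_le_mul_of_nonneg_left hRε hε0.le]
  have hclip := abs_clippedSqrt_sub_sqrt_le hε0 (R := R) (by rwa [hR2]) x'
  linarith [abs_sub_le (softBisect g n (R / 4) (R / 2)) (clippedSqrt R x') √x]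

end SquareRoot

section Attention

open Matrix

variable {a b m : ℕ}

theorem colSoftmax_zero {n : ℕ} (lam : ℝ) :
    colSoftmax lam (0 : Matrix (Fin m) (Fin n) ℝ) = of fun _ _ => (1 / m : ℝ) := by
  ext p q
  simp [colSoftmax]

theorem colSoftmax_one (lam : ℝ) :
    colSoftmax lam (1 : Matrix (Fin m) (Fin m) ℝ) =
      of fun p q => (if p = q then Real.exp lam else 1) / (Real.exp lam - 1 + m) := by
  have hexp (p q : Fin m) : Real.exp (lam * (1 : Matrix (Fin m) (Fin m) ℝ) p q) =
      (if p = q then Real.exp lam - 1 else 0) + 1 := by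
    rw [one_apply]
    split_ifs <;> simp
  ext p q
  simp only [colSoftmax, of_apply, hexp, Finset.sum_add_distrib, Finset.sum_ite_eq',
    Finset.mem_univ, if_true, Finset.sum_const, Finset.card_univ, Fintype.card_fin, nsmul_eq_mul,
    mul_one]
  split_ifs <;> simp

theorem smul_colSoftmax_one_sub_smul_colSoftmax_zero {lam : ℝ} (hlam : 0 < lam) :
    ((Real.exp lam - 1 + m) / (Real.exp lam - 1)) • colSoftmax lam (1 : Matrix (Fin m) (Fin m) ℝ) -
      (m / (Real.exp lam - 1)) • colSoftmax lam (0 : Matrix (Fin m) (Fin m) ℝ) = 1 := by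
  have hE : 0 < Real.exp lam - 1 := sub_pos.2 (Real.one_lt_exp_iff.2 hlam)
  ext p q
  have hm : (0 : ℝ) < m := by exact_mod_cast p.pos
  rw [colSoftmax_one, colSoftmax_zero]
  simp only [Matrix.sub_apply, Matrix.smul_apply, of_apply, smul_eq_mul, one_apply]
  split_ifs <;> field_simp
  all_goals simp

namespace AttnHead

/-- The head by which, if the `p`-th token is marked by the `p`-th unit vector in the coordinates
`i`, every token attends to itself with score one and to the other tokens with score zero. -/
def selfAttending (i : Fin m → Fin a) (V : Matrix (Fin b) (Fin a) ℝ) : AttnHead a b where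
  dh := m
  WK := (1 : Matrix (Fin a) (Fin a) ℝ).submatrix i id
  WQ := (1 : Matrix (Fin a) (Fin a) ℝ).submatrix i id
  WV := V

/-- The head by which every token attends to all tokens equally. -/
def uniform (V : Matrix (Fin b) (Fin a) ℝ) : AttnHead a b where
  dh := 1
  WK := 0
  WQ := 0
  WV := V

/-- The head by which a token `z` attends to a token `z'` with score `z' i * (w ⬝ᵥ z)`. If the
coordinate `i` marks one of two tokens, then `w ⬝ᵥ z` decides between the two. -/
def comparing (i : Fin a) (w : Fin a → ℝ) (V : Matrix (Fin b) (Fin a) ℝ) : AttnHead a b where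
  dh := 1
  WK := replicateRow (Fin 1) (Pi.single i 1)
  WQ := replicateRow (Fin 1) w
  WV := V

theorem eval_mk (lam : ℝ) {dh : ℕ} (WK WQ : Matrix (Fin dh) (Fin a) ℝ)
    (WV : Matrix (Fin b) (Fin a) ℝ) (Z : Matrix (Fin a) (Fin m) ℝ) :
    (AttnHead.mk dh WK WQ WV).eval lam Z = WV * Z * colSoftmax lam ((WK * Z)ᵀ * (WQ * Z)) :=
  rfl

theorem eval_selfAttending (lam : ℝ) {i : Fin m → Fin a} (V : Matrix (Fin b) (Fin a) ℝ)
    {Z : Matrix (Fin a) (Fin m) ℝ} (hZ : Z.submatrix i id = 1) :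
    (selfAttending i V).eval lam Z = V * Z * colSoftmax lam (1 : Matrix (Fin m) (Fin m) ℝ) := by
  have hproj : (1 : Matrix (Fin a) (Fin a) ℝ).submatrix i id * Z = 1 :=
    (one_submatrix_mul i (Equiv.refl _) Z).trans hZ
  rw [selfAttending, eval_mk, hproj, transpose_one, Matrix.one_mul]

theorem eval_uniform (lam : ℝ) (V : Matrix (Fin b) (Fin a) ℝ) (Z : Matrix (Fin a) (Fin m) ℝ) :
    (uniform V).eval lam Z = V * Z * colSoftmax lam (0 : Matrix (Fin m) (Fin m) ℝ) := by
  rw [uniform, eval_mk, Matrix.zero_mul, Matrix.mul_zero]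

theorem eval_comparing (lam : ℝ) (i : Fin a) (w : Fin a → ℝ) (V : Matrix (Fin b) (Fin a) ℝ)
    (Z : Matrix (Fin a) (Fin m) ℝ) :
    (comparing i w V).eval lam Z = V * Z * colSoftmax lam (vecMulVec (Z i) (w ᵥ* Z)) := by
  rw [comparing, eval_mk, ← replicateRow_vecMul, ← replicateRow_vecMul, single_one_vecMul,
    transpose_replicateRow, vecMulVec_eq (Fin 1)]
  rfl

theorem eval_selfAttending_add_eval_uniform {lam : ℝ} (hlam : 0 < lam) {i : Fin m → Fin a}
    (L : Matrix (Fin b) (Fin a) ℝ) {Z : Matrix (Fin a) (Fin m) ℝ} (hZ : Z.submatrix i id = 1) :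
    (selfAttending i (((Real.exp lam - 1 + m) / (Real.exp lam - 1)) • L)).eval lam Z +
      (uniform (-(m / (Real.exp lam - 1)) • L)).eval lam Z = L * Z := by
  rw [eval_selfAttending lam _ hZ, eval_uniform, Matrix.smul_mul, Matrix.smul_mul, Matrix.smul_mul,
    Matrix.smul_mul, neg_smul, ← sub_eq_add_neg, ← Matrix.mul_smul, ← Matrix.mul_smul,
    ← Matrix.mul_sub, smul_colSoftmax_one_sub_smul_colSoftmax_zero hlam, Matrix.mul_one]

end AttnHead

theorem colSoftmax_vecMulVec {n : ℕ} (lam : ℝ) (v : Fin n → ℝ) :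
    colSoftmax lam (vecMulVec ![1, 0] v) =
      of ![fun q => Real.sigmoid (lam * v q), fun q => Real.sigmoid (-(lam * v q))] := by
  ext p q
  rw [colSoftmax, of_apply, Fin.sum_univ_two]
  fin_cases p
  · suffices Real.exp (lam * v q) / (Real.exp (lam * v q) + 1) =
        (1 + (Real.exp (lam * v q))⁻¹)⁻¹ by
      simpa [vecMulVec_apply, Real.sigmoid_def, Real.exp_neg] using this
    field_simp
  · simp [vecMulVec_apply, Real.sigmoid_def, add_comm]

theorem colSoftmax_vecMulVec_sub_colSoftmax_zero {n : ℕ} (lam : ℝ) (v : Fin n → ℝ) :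
    colSoftmax lam (vecMulVec ![1, 0] v) - colSoftmax lam 0 =
      vecMulVec ![1, -1] fun q => Real.tanh (lam / 2 * v q) / 2 := by
  have hsigmoid (u : ℝ) : Real.sigmoid u - 1 / 2 = Real.tanh (u / 2) / 2 := by
    rw [sigmoid_eq_one_add_tanh_half_div_two]
    ring
  rw [colSoftmax_vecMulVec, colSoftmax_zero]
  ext p q
  fin_cases p
  · simpa [vecMulVec_apply, mul_div_right_comm] using hsigmoid (lam * v q)
  · simpa [vecMulVec_apply, mul_div_right_comm, neg_div, Real.tanh_neg] using
      hsigmoid (-(lam * v q))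

namespace AttnHead

theorem eval_comparing_add_eval_uniform (lam : ℝ) {i : Fin a} (w : Fin a → ℝ)
    (V : Matrix (Fin b) (Fin a) ℝ) {Z : Matrix (Fin a) (Fin 2) ℝ} (hZ : Z i = ![1, 0]) :
    (comparing i w V).eval lam Z + (uniform (-V)).eval lam Z =
      vecMulVec (V *ᵥ Z *ᵥ ![1, -1]) fun q => Real.tanh (lam / 2 * (w ᵥ* Z) q) / 2 := by
  rw [eval_comparing, eval_uniform, hZ, Matrix.neg_mul, Matrix.neg_mul, ← sub_eq_add_neg,
    ← Matrix.mul_sub, colSoftmax_vecMulVec_sub_colSoftmax_zero, mul_vecMulVec, mulVec_mulVec]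

end AttnHead

/-- On two tokens marked by the coordinates `i`, the layer that computes the linear map `L` and adds
to it the linear map `V` of the difference of the tokens, gated by a hyperbolic tangent of `w`. -/
noncomputable def gatedLayer (lam : ℝ) (i : Fin 2 → Fin a) (L V : Matrix (Fin b) (Fin a) ℝ)
    (w : Fin a → ℝ) : Fin 4 → AttnHead a b :=
  ![.selfAttending i (((Real.exp lam - 1 + (2 : ℕ)) / (Real.exp lam - 1)) • L),
    .uniform (-((2 : ℕ) / (Real.exp lam - 1)) • L), .comparing (i 0) w V, .uniform (-V)]

theorem attnLayer_gatedLayer {lam : ℝ} (hlam : 0 < lam) {i : Fin 2 → Fin a}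
    (L V : Matrix (Fin b) (Fin a) ℝ) (w : Fin a → ℝ) {Z : Matrix (Fin a) (Fin 2) ℝ}
    (hZ : Z.submatrix i id = 1) :
    attnLayer (gatedLayer lam i L V w) lam Z =
      L * Z + vecMulVec (V *ᵥ Z *ᵥ ![1, -1]) fun q => Real.tanh (lam / 2 * (w ᵥ* Z) q) / 2 := by
  have hrow : Z (i 0) = ![1, 0] := (congrFun hZ 0).trans (by ext q; fin_cases q <;> rfl)
  rw [attnLayer, Fin.sum_univ_four, ← AttnHead.eval_selfAttending_add_eval_uniform hlam L hZ,
    ← AttnHead.eval_comparing_add_eval_uniform lam w V hrow, ← add_assoc]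
  rfl

end Attention

section WeightNorms

open Matrix
open scoped Matrix.Norms.Frobenius

variable {a b c m H W : ℕ} {CKQ CV lam : ℝ}

section FrobeniusNorm

variable {ι κ : Type*} [Fintype ι] [Fintype κ]

theorem frobenius_norm_eq_sqrt_sum_sq (A : Matrix ι κ ℝ) : ‖A‖ = √(∑ i, ∑ j, A i j ^ 2) := by
  simp only [frobenius_norm_def, Real.rpow_two, Real.norm_eq_abs, sq_abs, ← Real.sqrt_eq_rpow]

theorem frobenius_norm_le_of_sum_sq_le {A : Matrix ι κ ℝ} {B : ℝ} (hB : 0 ≤ B)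
    (hA : ∑ i, ∑ j, A i j ^ 2 ≤ B ^ 2) : ‖A‖ ≤ B :=
  (frobenius_norm_eq_sqrt_sum_sq A).trans_le (Real.sqrt_le_iff.2 ⟨hB, hA⟩)

theorem frobenius_norm_single [DecidableEq ι] [DecidableEq κ] (i : ι) (j : κ) (r : ℝ) :
    ‖single i j r‖ = |r| := by
  have hrow (p : ι) : ∑ q, single i j r p q ^ 2 = if i = p then r ^ 2 else 0 := by
    by_cases hp : i = p <;> simp [single_apply, hp]
  simp only [frobenius_norm_eq_sqrt_sum_sq, hrow, Finset.sum_ite_eq, Finset.mem_univ, if_true,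
    Real.sqrt_sq_eq_abs]

end FrobeniusNorm

namespace AttnHead

theorem WKQ_mk {dh : ℕ} (WK WQ : Matrix (Fin dh) (Fin a) ℝ) (WV : Matrix (Fin b) (Fin a) ℝ) :
    (AttnHead.mk dh WK WQ WV).WKQ = WKᵀ * WQ :=
  rfl

theorem norm_WKQ_selfAttending_le (i : Fin m → Fin a) (V : Matrix (Fin b) (Fin a) ℝ) :
    ‖(selfAttending i V).WKQ‖ ≤ m := by
  have hnorm : ‖(1 : Matrix (Fin a) (Fin a) ℝ).submatrix i id‖ ≤ √m :=
    frobenius_norm_le_of_sum_sq_le (Real.sqrt_nonneg _) (by simp [one_apply])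
  rw [selfAttending, WKQ_mk]
  calc
    _ ≤ √m * √m := by
      refine (frobenius_norm_mul _ _).trans ?_
      rw [frobenius_norm_transpose]
      gcongr
    _ = m := Real.mul_self_sqrt m.cast_nonneg

theorem WKQ_selfAttending_ne_zero [NeZero m] (i : Fin m → Fin a) (V : Matrix (Fin b) (Fin a) ℝ) :
    (selfAttending i V).WKQ ≠ 0 := by
  intro hzero
  rw [selfAttending, WKQ_mk, ← conjTranspose_eq_transpose_of_trivial,
    conjTranspose_mul_self_eq_zero] at hzero
  exact one_ne_zero ((one_apply_eq (i 0)).symm.trans (congrFun (congrFun hzero 0) (i 0)))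

theorem norm_WKQ_uniform (V : Matrix (Fin b) (Fin a) ℝ) : ‖(uniform V).WKQ‖ = 0 := by
  rw [uniform, WKQ_mk, Matrix.mul_zero, norm_zero]

theorem WKQ_comparing (i : Fin a) (w : Fin a → ℝ) (V : Matrix (Fin b) (Fin a) ℝ) :
    (comparing i w V).WKQ = vecMulVec (Pi.single i 1) w :=
  (vecMulVec_eq (Fin 1) _ _).symm

theorem norm_WKQ_comparing_le (i : Fin a) (w : Fin a → ℝ) (V : Matrix (Fin b) (Fin a) ℝ) :
    ‖(comparing i w V).WKQ‖ ≤ ‖WithLp.toLp 2 w‖ := by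
  rw [WKQ_comparing]
  refine frobenius_norm_le_of_sum_sq_le (norm_nonneg _) ?_
  rw [EuclideanSpace.real_norm_sq_eq]
  simp [vecMulVec_apply, Pi.single_apply]

end AttnHead

variable {i : Fin 2 → Fin a} {L V : Matrix (Fin b) (Fin a) ℝ} {w : Fin a → ℝ}

theorem norm_WKQ_gatedLayer_le (hCKQ : 2 ≤ CKQ) (hw : ‖WithLp.toLp 2 w‖ ≤ CKQ) (h : Fin 4) :
    ‖(gatedLayer lam i L V w h).WKQ‖ ≤ CKQ := by
  have h0 : 0 ≤ CKQ := by linarith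
  fin_cases h
  · exact (AttnHead.norm_WKQ_selfAttending_le _ _).trans hCKQ
  · exact (AttnHead.norm_WKQ_uniform _).trans_le h0
  · exact (AttnHead.norm_WKQ_comparing_le _ _ _).trans hw
  · exact (AttnHead.norm_WKQ_uniform _).trans_le h0

theorem norm_WV_gatedLayer_le (hlam : 2 ≤ lam) (hL : ‖L‖ ≤ CV / 2) (hV : ‖V‖ ≤ CV) (h : Fin 4) :
    ‖(gatedLayer lam i L V w h).WV‖ ≤ CV := by
  have hE : 3 ≤ Real.exp lam := by linarith [Real.add_one_le_exp lam]
  have hsmul {r : ℝ} (hr0 : 0 ≤ r) (hr2 : r ≤ 2) : ‖r • L‖ ≤ CV := by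
    rw [norm_smul, Real.norm_of_nonneg hr0]
    linarith [mul_le_mul_of_nonneg_right hr2 (norm_nonneg L)]
  fin_cases h
  · refine hsmul (div_nonneg ?_ ?_) ((div_le_iff₀ ?_).2 ?_) <;> push_cast <;> linarith
  · change ‖-(((2 : ℕ) : ℝ) / (Real.exp lam - 1)) • L‖ ≤ CV
    rw [neg_smul, norm_neg]
    refine hsmul (div_nonneg ?_ ?_) ((div_le_iff₀ ?_).2 ?_) <;> push_cast <;> linarith
  · exact hV
  · exact (norm_neg V).trans_le hV

theorem dh_gatedLayer_le (h : Fin 4) : (gatedLayer lam i L V w h).dh ≤ 2 := by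
  fin_cases h <;> norm_num [gatedLayer, AttnHead.selfAttending, AttnHead.uniform,
    AttnHead.comparing]

namespace AttnStack

/-- Bounds on the width of a Transformer and on the Frobenius norms of its weights. -/
structure BoundedBy (s : AttnStack H a c) (W : ℕ) (CKQ CV : ℝ) : Prop where
  width_le : s.width ≤ W
  maxNormKQ_le : s.maxNormKQ ≤ CKQ
  maxNormV_le : s.maxNormV ≤ CV

theorem BoundedBy.nil (hd : a ≤ W) (hKQ : 0 ≤ CKQ) (hV : 0 ≤ CV) :
    (nil a : AttnStack H a a).BoundedBy W CKQ CV :=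
  ⟨hd, hKQ, hV⟩

theorem BoundedBy.cons [Nonempty (Fin H)] {layer : Fin H → AttnHead a b} {s : AttnStack H b c}
    (hs : s.BoundedBy W CKQ CV) (ha : a ≤ W) (hdh : ∀ h, (layer h).dh ≤ W)
    (hKQ : ∀ h, ‖(layer h).WKQ‖ ≤ CKQ) (hV : ∀ h, ‖(layer h).WV‖ ≤ CV) :
    (AttnStack.cons layer s).BoundedBy W CKQ CV where
  width_le := max_le (max_le ha (Finset.sup_le fun h _ => hdh h)) hs.width_le
  maxNormKQ_le := max_le (ciSup_le hKQ) hs.maxNormKQ_le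
  maxNormV_le := max_le (ciSup_le hV) hs.maxNormV_le

theorem BoundedBy.cons_gatedLayer {s : AttnStack 4 b c} (hs : s.BoundedBy W CKQ CV)
    (hlam : 2 ≤ lam) (ha : a ≤ W) (hW : 2 ≤ W) (hCKQ : 2 ≤ CKQ) (hw : ‖WithLp.toLp 2 w‖ ≤ CKQ)
    (hL : ‖L‖ ≤ CV / 2) (hV : ‖V‖ ≤ CV) :
    (AttnStack.cons (gatedLayer lam i L V w) s).BoundedBy W CKQ CV :=
  hs.cons ha (fun h => (dh_gatedLayer_le h).trans hW) (norm_WKQ_gatedLayer_le hCKQ hw)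
    (norm_WV_gatedLayer_le hlam hL hV)

theorem maxNormKQ_pos_of_ne_zero {layer : Fin H → AttnHead a b} {h : Fin H}
    (hne : (layer h).WKQ ≠ 0) (s : AttnStack H b c) : 0 < (cons layer s).maxNormKQ :=
  (norm_pos_iff.2 hne).trans_le <| (le_ciSup (f := fun h => ‖(layer h).WKQ‖)
    (Set.finite_range _).bddAbove h).trans (le_max_left _ _)

theorem maxNormV_pos_of_ne_zero {layer : Fin H → AttnHead a b} {h : Fin H}
    (hne : (layer h).WV ≠ 0) (s : AttnStack H b c) : 0 < (cons layer s).maxNormV :=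
  (norm_pos_iff.2 hne).trans_le <| (le_ciSup (f := fun h => ‖(layer h).WV‖)
    (Set.finite_range _).bddAbove h).trans (le_max_left _ _)

theorem maxNormKQ_cons_gatedLayer_pos (s : AttnStack 4 b c) :
    0 < (cons (gatedLayer lam i L V w) s).maxNormKQ :=
  maxNormKQ_pos_of_ne_zero (h := 0) (AttnHead.WKQ_selfAttending_ne_zero _ _) s

theorem maxNormV_cons_gatedLayer_pos (hlam : 0 < lam) (hL : L ≠ 0) (s : AttnStack 4 b c) :
    0 < (cons (gatedLayer lam i L V w) s).maxNormV := by
  have hE : 1 < Real.exp lam := Real.one_lt_exp_iff.2 hlam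
  refine maxNormV_pos_of_ne_zero (h := 0) (smul_ne_zero (div_pos ?_ ?_).ne' hL) s
  · push_cast
    linarith
  · linarith

end AttnStack

end WeightNorms

section SquareRootNetwork

open Matrix
open scoped Matrix.Norms.Frobenius

/-- The state `(x, y, t)` of the bisection in the first of two tokens, with positional encoding:
`x` is the input, `y` the current approximation of its square root, and `t` a register for the
argument of the comparison. -/
def bisectState (x y t : ℝ) : Matrix (Fin 5) (Fin 2) ℝ :=
  !![x, 0; y, 0; t, 0; 1, 0; 0, 1]

/-- The layer `(x, y, t) ↦ (x, y, η * x - y * tanh (η * y))` on bisection states. -/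
noncomputable def squareLayer (lam η : ℝ) : Fin 4 → AttnHead 5 5 :=
  gatedLayer lam ![3, 4]
    !![1, 0, 0, 0, 0; 0, 1, 0, 0, 0; η, 0, 0, 0, 0; 0, 0, 0, 1, 0; 0, 0, 0, 0, 1]
    (single 2 1 (-2)) (Pi.single 1 (2 * η / lam))

/-- The layer `(x, y, t) ↦ (x, y + s * tanh (lam / 2 * t), 0)` on bisection states. -/
noncomputable def stepLayer (lam s : ℝ) : Fin 4 → AttnHead 5 5 :=
  gatedLayer lam ![3, 4] (diagonal ![1, 1, 0, 1, 1]) (single 1 3 (2 * s)) (Pi.single 2 1)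

/-- The layer that turns the preprocessed input `x` into the bisection state `(x, y, 0)`. -/
noncomputable def embedLayer (lam y : ℝ) : Fin 4 → AttnHead 3 5 :=
  gatedLayer lam ![1, 2] !![1, 0, 0; 0, y, 0; 0, 0, 0; 0, 1, 0; 0, 0, 1] 0 0

/-- The layer that returns the component `y` of a bisection state. -/
noncomputable def readoutLayer (lam : ℝ) : Fin 4 → AttnHead 5 1 :=
  gatedLayer lam ![3, 4] (single 0 1 1) 0 0

theorem preprocess_one_one (x : ℝ) :
    preprocess !![x] = (!![x, 0; 1, 0; 0, 1] : Matrix (Fin 3) (Fin 2) ℝ) := by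
  ext p q
  fin_cases p <;> fin_cases q <;> rfl

theorem bisectState_submatrix (x y t : ℝ) : (bisectState x y t).submatrix ![3, 4] id = 1 := by
  ext p q
  fin_cases p <;> fin_cases q <;> rfl

section Layers

variable {lam : ℝ}

theorem bisectState_mulVec (x y t : ℝ) : bisectState x y t *ᵥ ![1, -1] = ![x, y, t, 1, -1] := by
  ext p
  fin_cases p <;> simp [bisectState, mulVec, dotProduct]

theorem attnLayer_squareLayer (hlam : 0 < lam) (η x y t : ℝ) :
    attnLayer (squareLayer lam η) lam (bisectState x y t) =
      bisectState x y (η * x - y * Real.tanh (η * y)) := by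
  have hscale : lam / 2 * (2 * η / lam * y) = η * y := by field_simp
  have hgate (v : ℝ) : 2 * y * (v / 2) = y * v := by ring
  rw [squareLayer, attnLayer_gatedLayer hlam _ _ _ (bisectState_submatrix x y t),
    bisectState_mulVec, single_mulVec, single_vecMul]
  ext p q
  fin_cases p <;> fin_cases q <;> simp [bisectState, vecMulVec_apply, hscale, hgate,
    sub_eq_add_neg]

theorem attnLayer_stepLayer (hlam : 0 < lam) (s x y t : ℝ) :
    attnLayer (stepLayer lam s) lam (bisectState x y t) =
      bisectState x (y + s * Real.tanh (lam / 2 * t)) 0 := by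
  have hgate (v : ℝ) : 2 * s * (v / 2) = s * v := by ring
  rw [stepLayer, attnLayer_gatedLayer hlam _ _ _ (bisectState_submatrix x y t),
    bisectState_mulVec, single_mulVec, single_one_vecMul]
  ext p q
  fin_cases p <;> fin_cases q <;> simp [bisectState, vecMulVec_apply, hgate]

theorem attnLayer_embedLayer (hlam : 0 < lam) (x y : ℝ) :
    attnLayer (embedLayer lam y) lam !![x, 0; 1, 0; 0, 1] = bisectState x y 0 := by
  rw [embedLayer, attnLayer_gatedLayer hlam _ _ _ (by ext p q; fin_cases p <;> fin_cases q <;> rfl),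
    zero_mulVec, zero_vecMulVec, add_zero]
  ext p q
  fin_cases p <;> fin_cases q <;> simp [bisectState]

theorem attnLayer_readoutLayer (hlam : 0 < lam) (x y t : ℝ) :
    attnLayer (readoutLayer lam) lam (bisectState x y t) = !![y, 0] := by
  rw [readoutLayer, attnLayer_gatedLayer hlam _ _ _ (bisectState_submatrix x y t),
    zero_mulVec, zero_vecMulVec, add_zero]
  ext p q
  fin_cases p; fin_cases q <;> simp [bisectState]

end Layers

namespace AttnStack

/-- `n` steps of bisection with first step width `s`, followed by the readout. -/
noncomputable def bisect (lam η : ℝ) : ℕ → ℝ → AttnStack 4 5 1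
  | 0, _ => cons (readoutLayer lam) (nil 1)
  | n + 1, s => cons (squareLayer lam η) (cons (stepLayer lam s) (bisect lam η n (s / 2)))

/-- `n` steps of bisection for a square root in `[0, R]`, started at the midpoint. -/
noncomputable def sqrtNet (lam η R : ℝ) (n : ℕ) : AttnStack 4 3 1 :=
  cons (embedLayer lam (R / 2)) (bisect lam η n (R / 4))

variable {lam η R : ℝ}

theorem eval_bisect (hlam : 0 < lam) (η x : ℝ) (n : ℕ) (s y t : ℝ) :
    (bisect lam η n s).eval lam (bisectState x y t) =
      !![softBisect (sqCompare η (lam / 2) x) n s y, 0] := by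
  induction n generalizing s y t with
  | zero => rw [bisect, eval, eval, attnLayer_readoutLayer hlam, softBisect]
  | succ n ih =>
    rw [bisect, eval, eval, attnLayer_squareLayer hlam, attnLayer_stepLayer hlam, ih, softBisect,
      sqCompare]

theorem eval_sqrtNet (hlam : 0 < lam) (η R x : ℝ) (n : ℕ) :
    (sqrtNet lam η R n).eval lam (preprocess !![x]) =
      !![softBisect (sqCompare η (lam / 2) x) n (R / 4) (R / 2), 0] := by
  rw [preprocess_one_one, sqrtNet, eval, attnLayer_embedLayer hlam, eval_bisect hlam]

theorem depth_bisect (lam η : ℝ) (n : ℕ) (s : ℝ) : (bisect lam η n s).depth = 2 * n + 1 := by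
  induction n generalizing s with
  | zero => rfl
  | succ n ih =>
    rw [bisect, depth, depth, ih]
    ring

theorem depth_sqrtNet (lam η R : ℝ) (n : ℕ) : (sqrtNet lam η R n).depth = 2 * n + 2 := by
  rw [sqrtNet, depth, depth_bisect]

variable {c : ℕ} {s CV : ℝ} {S : AttnStack 4 5 c}

theorem BoundedBy.cons_squareLayer (hS : S.BoundedBy 5 2 CV) (hlam : 2 ≤ lam) (hη0 : 0 ≤ η)
    (hη1 : η ≤ 1) (hCV : 5 ≤ CV) : (AttnStack.cons (squareLayer lam η) S).BoundedBy 5 2 CV := by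
  refine hS.cons_gatedLayer hlam le_rfl (by norm_num) le_rfl ?_ ?_ ?_
  · rw [PiLp.toLp_single, PiLp.norm_single, Real.norm_of_nonneg (by positivity),
      div_le_iff₀ (by linarith)]
    linarith
  · refine (frobenius_norm_le_of_sum_sq_le (B := 5 / 2) (by norm_num) ?_).trans (by linarith)
    suffices 1 + 1 + η ^ 2 + 1 + 1 ≤ (5 / 2) ^ 2 by simpa [Fin.sum_univ_five] using this
    nlinarith
  · rw [frobenius_norm_single]
    norm_num
    linarith

theorem BoundedBy.cons_stepLayer (hS : S.BoundedBy 5 2 CV) (hlam : 2 ≤ lam) (hs : 0 ≤ s)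
    (hsCV : 2 * s ≤ CV) (hCV : 5 ≤ CV) : (AttnStack.cons (stepLayer lam s) S).BoundedBy 5 2 CV := by
  refine hS.cons_gatedLayer hlam le_rfl (by norm_num) le_rfl ?_ ?_ ?_
  · rw [PiLp.toLp_single, PiLp.norm_single]
    norm_num
  · have hL : ‖(diagonal ![1, 1, 0, 1, 1] : Matrix (Fin 5) (Fin 5) ℝ)‖ ≤ 2 := by
      rw [frobenius_norm_diagonal, EuclideanSpace.norm_eq, Real.sqrt_le_iff]
      suffices (1 : ℝ) + 1 + 1 + 1 ≤ 2 ^ 2 by simpa [Fin.sum_univ_five] using this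
      norm_num
    exact hL.trans (by linarith)
  · rwa [frobenius_norm_single, abs_of_nonneg (by positivity)]

theorem boundedBy_bisect (hlam : 2 ≤ lam) (hη0 : 0 ≤ η) (hη1 : η ≤ 1) (hCV : 5 ≤ CV) (n : ℕ)
    (hs : 0 ≤ s) (hsCV : 2 * s ≤ CV) : (bisect lam η n s).BoundedBy 5 2 CV := by
  induction n generalizing s with
  | zero =>
    refine (BoundedBy.nil (by norm_num) zero_le_two (by linarith)).cons_gatedLayer hlam le_rfl
      (by norm_num) le_rfl (by simp) ?_ (norm_zero.trans_le (by linarith))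
    rw [frobenius_norm_single]
    norm_num
    linarith
  | succ n ih =>
    exact ((ih (by linarith) (by linarith)).cons_stepLayer hlam hs hsCV hCV).cons_squareLayer
      hlam hη0 hη1 hCV

theorem boundedBy_sqrtNet (hlam : 2 ≤ lam) (hη0 : 0 ≤ η) (hη1 : η ≤ 1) (hR : 1 ≤ R) (n : ℕ) :
    (sqrtNet lam η R n).BoundedBy 5 2 (5 * R) := by
  refine (boundedBy_bisect hlam hη0 hη1 (by linarith) n (by linarith)
    (by linarith)).cons_gatedLayer hlam (by norm_num) (by norm_num) le_rfl (by simp) ?_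
    (norm_zero.trans_le (by linarith))
  refine (frobenius_norm_le_of_sum_sq_le (B := 5 / 2 * R) (by linarith) ?_).trans (by linarith)
  suffices 1 + (R / 2) ^ 2 + 1 + 1 ≤ (5 / 2 * R) ^ 2 by
    simpa [Fin.sum_univ_five, Fin.sum_univ_three] using this
  nlinarith

theorem maxNormKQ_sqrtNet_pos (lam η R : ℝ) (n : ℕ) : 0 < (sqrtNet lam η R n).maxNormKQ :=
  maxNormKQ_cons_gatedLayer_pos _

theorem maxNormV_sqrtNet_pos (hlam : 0 < lam) (η R : ℝ) (n : ℕ) :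
    0 < (sqrtNet lam η R n).maxNormV :=
  maxNormV_cons_gatedLayer_pos hlam
    (fun hL => one_ne_zero (congrFun (congrFun hL 0) 0 : (1 : ℝ) = 0)) _

end AttnStack

end SquareRootNetwork

section Rates

theorem sq_le_two_pow_ceil_log {δ : ℝ} (hδ : 1 ≤ δ) : δ ^ 2 ≤ 2 ^ ⌈3 * Real.log δ⌉₊ := by
  have hδ0 : 0 < δ := by linarith
  rw [← Real.log_le_log_iff (pow_pos hδ0 2) (by positivity), Real.log_pow, Real.log_pow]
  calc
    (2 : ℕ) * Real.log δ ≤ 3 * Real.log δ * Real.log 2 := by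
      push_cast
      nlinarith [Real.log_nonneg hδ, Real.log_two_gt_d9]
    _ ≤ ⌈3 * Real.log δ⌉₊ * Real.log 2 := by
      gcongr
      exact Nat.le_ceil _

theorem polylog_bounds_of_le {W K : ℕ} {CKQ CV δ CX : ℝ} (hδ : 2 ≤ δ) (hCX : 1 ≤ CX)
    (hW : W ≤ 5) (hK : (K : ℝ) ≤ 6 * Real.log δ + 4) (hCV : CV ≤ 5 * √δ) (hCKQ : CKQ ≤ 2) :
    ((4 : ℕ) : ℝ) ≤ 64 * Real.log δ ^ 3 ∧
      (W : ℝ) ≤ 64 * Real.log δ ^ 3 ∧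
      (K : ℝ) ≤ 64 * Real.log δ ^ 2 ∧
      CV ≤ 64 * (δ * √(Real.log δ ^ 3)) ∧
      CKQ ≤ 64 * √(Real.log δ ^ 2 * Real.log (δ * CX)) ∧
      32 * δ ^ 6 ≤ 64 * (δ ^ (Polynomial.C 6).eval (Real.log δ) *
        Real.log δ ^ (0 : Polynomial ℝ).eval (Real.log δ) * Real.log (δ * CX)) := by
  have hlog : 1 / 2 ≤ Real.log δ := by
    linarith [Real.log_two_gt_d9, Real.log_le_log zero_lt_two hδ]
  have hlogX : 1 / 2 ≤ Real.log (δ * CX) :=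
    hlog.trans (Real.log_le_log (by linarith) (le_mul_of_one_le_right (by linarith) hCX))
  have hlog3 : (1 / 2) ^ 3 ≤ Real.log δ ^ 3 := by gcongr
  have hlogX3 : (1 / 2) ^ 2 * (1 / 2) ≤ Real.log δ ^ 2 * Real.log (δ * CX) := by gcongr
  have hW' : (W : ℝ) ≤ 5 := by exact_mod_cast hW
  refine ⟨by norm_num; linarith, by linarith, by nlinarith, ?_, ?_, ?_⟩
  · have hsqrt : 1 / 4 ≤ √(Real.log δ ^ 3) := Real.le_sqrt_of_sq_le (by linarith)
    calc
      CV ≤ 5 * √δ := hCV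
      _ ≤ 5 * δ := by
        gcongr
        exact Real.sqrt_le_self_iff.2 (.inr (by linarith))
      _ ≤ 64 * (δ * (1 / 4)) := by linarith
      _ ≤ 64 * (δ * √(Real.log δ ^ 3)) := by gcongr
  · have hsqrt : 1 / 4 ≤ √(Real.log δ ^ 2 * Real.log (δ * CX)) :=
      Real.le_sqrt_of_sq_le (by linarith)
    linarith
  · rw [Polynomial.eval_C, Polynomial.eval_zero, Real.rpow_zero, mul_one, Real.rpow_ofNat]
    linarith [mul_le_mul_of_nonneg_left hlogX (by positivity : 0 ≤ δ ^ 6)]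

end Rates

theorem mainTheorem7_general {ε : ℝ} (hε0 : 0 < ε) (hε1 : ε < 1) :
    ∃ (W K : ℕ) (CKQ CV : ℝ), 0 < CKQ ∧ 0 < CV ∧ W ≤ 5 ∧ (K : ℝ) ≤ 6 * Real.log (1 / ε) + 4 ∧
      CV ≤ 5 * √(1 / ε) ∧ CKQ ≤ 2 ∧ ∃ f ∈ TransformerClass 1 1 1 4 W K CKQ CV (32 * (1 / ε) ^ 6),
        ∀ x' : ℝ, ∀ x ∈ Set.Icc ε (1 / ε),
          |f !![x'] 0 0 - √x| ≤ 2 * ε + |x' - x| / √ε := by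
  have hδ : 1 ≤ 1 / ε := (one_lt_one_div hε0 hε1).le
  have hlam : 2 ≤ 32 * (1 / ε) ^ 6 := by linarith [one_le_pow₀ hδ (n := 6)]
  have hlam0 : 0 < 32 * (1 / ε) ^ 6 := by positivity
  set n := ⌈3 * Real.log (1 / ε)⌉₊
  set s := AttnStack.sqrtNet (32 * (1 / ε) ^ 6) (ε ^ 2 / 2) √(1 / ε) n with hs
  have hbound : s.BoundedBy 5 2 (5 * √(1 / ε)) :=
    AttnStack.boundedBy_sqrtNet hlam (by positivity) (by nlinarith) (Real.one_le_sqrt.2 hδ) n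
  have hdepth : (s.depth : ℝ) ≤ 6 * Real.log (1 / ε) + 4 := by
    have hn := Nat.ceil_lt_add_one (mul_nonneg zero_le_three (Real.log_nonneg hδ))
    rw [AttnStack.depth_sqrtNet]
    push_cast
    linarith
  refine ⟨s.width, s.depth, s.maxNormKQ, s.maxNormV, AttnStack.maxNormKQ_sqrtNet_pos _ _ _ _,
    AttnStack.maxNormV_sqrtNet_pos hlam0 _ _ _, hbound.width_le, hdepth, hbound.maxNormV_le,
    hbound.maxNormKQ_le, fun X => truncateLast (s.eval (32 * (1 / ε) ^ 6) (preprocess X)),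
    ⟨s, rfl, rfl, rfl, rfl, fun _ => rfl⟩, fun x' x hx => ?_⟩
  have heval := AttnStack.eval_sqrtNet hlam0 (ε ^ 2 / 2) √(1 / ε) x' n
  rw [show 32 * (1 / ε) ^ 6 / 2 = 16 * (1 / ε) ^ 6 by ring] at heval
  change |s.eval _ (preprocess !![x']) 0 0 - √x| ≤ _
  rw [hs, heval]
  exact abs_softBisect_sqCompare_sub_sqrt_le hε0 hε1 hx (sq_le_two_pow_ceil_log hδ)

theorem mainTheorem7 :
    ∃ (C : ℝ) (p q : Polynomial ℝ), 0 < C ∧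
      ∀ CX : ℝ, 0 < CX → ∀ ε : ℝ, 0 < ε → ε < 1 →
        ∃ (H W K : ℕ) (CKQ CV lam : ℝ), 0 < CKQ ∧ 0 < CV ∧ 0 < lam ∧
          ∃ f ∈ TransformerClass 1 1 1 H W K CKQ CV lam,
            (∀ x' ∈ Set.Icc (-CX) CX, ∀ x ∈ Set.Icc ε (1 / ε),
              |f !![x'] 0 0 - Real.sqrt x| ≤ 2 * ε + |x' - x| / Real.sqrt ε) ∧
            (1 ≤ CX → ε ≤ 1 / 2 → ∀ δ : ℝ, δ = 1 / ε →
              (H : ℝ) ≤ C * Real.log δ ^ 3 ∧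
              (W : ℝ) ≤ C * Real.log δ ^ 3 ∧
              (K : ℝ) ≤ C * Real.log δ ^ 2 ∧
              CV ≤ C * (δ * Real.sqrt (Real.log δ ^ 3)) ∧
              CKQ ≤ C * Real.sqrt (Real.log δ ^ 2 * Real.log (δ * CX)) ∧
              lam ≤ C * (δ ^ (p.eval (Real.log δ)) * Real.log δ ^ (q.eval (Real.log δ)) *
                Real.log (δ * CX))) := by
  refine ⟨64, .C 6, 0, by norm_num, fun CX _ ε hε0 hε1 => ?_⟩
  obtain ⟨W, K, CKQ, CV, hCKQ0, hCV0, hW, hK, hCV, hCKQ, f, hf, happrox⟩ :=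
    mainTheorem7_general hε0 hε1
  refine ⟨4, W, K, CKQ, CV, 32 * (1 / ε) ^ 6, hCKQ0, hCV0, by positivity, f, hf,
    fun x' _ => happrox x', fun hCX hε2 δ hδ => ?_⟩
  subst hδ
  exact polylog_bounds_of_le ((le_one_div two_pos hε0).2 hε2) hCX hW hK hCV hCKQ
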